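/- Let $n\ge 1$ be an integer. For $c\ge 1$ let $P^n(c)$ be the set of all tuples $(A_1,A_2;C_1,\dots,C_n;e)\in \operatorname{End}(\mathbb{C}^c)^{\oplus n+2}\oplus\operatorname{Hom}(\mathbb{C}^c,\mathbb{C})$ such that (P1) $A_1C_1A_2=A_2C_1A_1$ if $n=1$, and $A_1C_q=A_2C_{q+1}$, $C_qA_1=C_{q+1}A_2$ for $q=1,\dots,n-1$ if $n>1$; (P2) there is $[\nu_1,\nu_2]\in\mathbb{P}^1$ with $\det(\nu_1A_1+\nu_2A_2)\ne 0$; (P3) for all $([\lambda_1,\lambda_2],(\mu_1,\mu_2))\in\mathbb{P}^1\times\mathbb{C}^2$ with $\lambda_1^n\mu_1+\lambda_2^n\mu_2=0$ there is no nonzero $v\in\mathbb{C}^c$ such that $(\lambda_2A_1+\lambda_1A_2)v=0$, $(C_1A_2+\mu_1\mathbf{1}_c)v=0$, $(C_nA_1+(-1)^{n-1}\mu_2\mathbf{1}_c)v=0$ and $ev=0$. The group $\operatorname{GL}(c,\mathbb{C})^{\times 2}$ acts on $P^n(c)$ by $(\phi_1,\phi_2)\cdot(A_i;C_j;e)=(\phi_2A_i\phi_1^{-1};\phi_1C_j\phi_2^{-1};e\phi_1^{-1})$.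 For $c=1$, the group is $(\mathbb{C}^*)^{\times 2}$; give $P^n(1)$ the structure of a quasi-affine variety (Zariski topology, regular functions) and $P^n(1)/(\mathbb{C}^*)^{\times 2}$ the quotient topology and the sheaf of invariant regular functions. Then there is an isomorphism of complex algebraic varieties $$P^n(1)/(\mathbb{C}^*)^{\times 2}\;\simeq\;\operatorname{Tot}(\mathcal{O}_{\mathbb{P}^1}(-n)),$$ where the right-hand side is the total space of the line bundle $\mathcal{O}_{\mathbb{P}^1}(-n)$. -/

import Mathlib

open scoped LinearAlgebra.Projectivization TensorProduct MatrixGroups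

noncomputable section

/-- A space with functions over a field `k` (a classical variety is one of these): a topological
space with a sheaf of `k`-algebras of `k`-valued functions such that the nonvanishing locus of a
regular function is open and the inverse of a nowhere vanishing regular function is regular.
`RegularOn U f` says that the restriction of `f` to the open set `U` is a section over `U`; by
`congr` it does not depend on the values of `f` outside `U`. -/
structure SpaceWithFunctions (k : Type) [Field k] where
  carrier : Type
  [top : TopologicalSpace carrier]
  RegularOn : TopologicalSpace.Opens carrier → (carrier → k) → Prop
  congr : ∀ {U f g}, (∀ x ∈ U, f x = g x) → RegularOn U f → RegularOn U g
  const : ∀ U (a : k), RegularOn U (fun _ => a)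
  add : ∀ {U f g}, RegularOn U f → RegularOn U g → RegularOn U (fun x => f x + g x)
  mul : ∀ {U f g}, RegularOn U f → RegularOn U g → RegularOn U (fun x => f x * g x)
  mono : ∀ {U V f}, V ≤ U → RegularOn U f → RegularOn V f
  glue : ∀ {U f}, (∀ x ∈ U, ∃ V, x ∈ V ∧ V ≤ U ∧ RegularOn V f) → RegularOn U f
  isOpen_ne_zero : ∀ {U f}, RegularOn U f → IsOpen {x | x ∈ U ∧ f x ≠ 0}
  inv : ∀ {U f}, RegularOn U f → (∀ x ∈ U, f x ≠ 0) → RegularOn U (fun x => (f x)⁻¹)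

namespace SpaceWithFunctions

attribute [instance] SpaceWithFunctions.top

variable {k : Type} [Field k]

/-- A morphism is a continuous map that pulls regular functions back to regular functions. -/
structure IsMorphism (X Y : SpaceWithFunctions k) (φ : X.carrier → Y.carrier) : Prop where
  continuous : Continuous φ
  regularOn_comp : ∀ (V : TopologicalSpace.Opens Y.carrier) (f : Y.carrier → k),
    Y.RegularOn V f → X.RegularOn ⟨φ ⁻¹' V, V.isOpen.preimage continuous⟩ (f ∘ φ)

/-- An isomorphism is a bijection that is a morphism in both directions. -/
structure Iso (X Y : SpaceWithFunctions k) where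
  toEquiv : X.carrier ≃ Y.carrier
  isMorphism_toFun : IsMorphism X Y toEquiv
  isMorphism_invFun : IsMorphism Y X toEquiv.symm

/-- The Zariski topology on a subset `X` of affine space, given by its coordinate functions. -/
abbrev zariskiTopology {X ι : Type} (coord : X → ι → k) : TopologicalSpace X :=
  TopologicalSpace.generateFrom
    {D | ∃ p : MvPolynomial ι k, D = {x | MvPolynomial.eval (coord x) p ≠ 0}}

/-- A (locally closed) subset `X` of affine space, given by its coordinate functions, with the
Zariski topology and the functions that are locally quotients of polynomials. -/
def ofCoordinates {X ι : Type} (coord : X → ι → k) : SpaceWithFunctions k :=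
  letI : TopologicalSpace X := zariskiTopology coord
  { carrier := X
    RegularOn := fun U f => ∀ x ∈ U, ∃ p q : MvPolynomial ι k,
      MvPolynomial.eval (coord x) q ≠ 0 ∧
        ∀ y ∈ U, MvPolynomial.eval (coord y) q ≠ 0 →
          f y = MvPolynomial.eval (coord y) p / MvPolynomial.eval (coord y) q
    congr := by
      intro U f g h hf x hx
      obtain ⟨p, q, hq, H⟩ := hf x hx
      exact ⟨p, q, hq, fun y hy hqy => by rw [← h y hy, H y hy hqy]⟩
    const := fun U a x hx => ⟨MvPolynomial.C a, 1, by simp, by simp⟩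
    add := by
      intro U f g hf hg x hx
      obtain ⟨p, q, hq, H⟩ := hf x hx
      obtain ⟨p', q', hq', H'⟩ := hg x hx
      refine ⟨p * q' + q * p', q * q', by simp [hq, hq'], fun y hy h => ?_⟩
      simp only [map_mul, ne_eq, mul_eq_zero, not_or] at h
      change _ + _ = _
      rw [H y hy h.1, H' y hy h.2, div_add_div _ _ h.1 h.2]
      simp
    mul := by
      intro U f g hf hg x hx
      obtain ⟨p, q, hq, H⟩ := hf x hx
      obtain ⟨p', q', hq', H'⟩ := hg x hx
      refine ⟨p * p', q * q', by simp [hq, hq'], fun y hy h => ?_⟩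
      simp only [map_mul, ne_eq, mul_eq_zero, not_or] at h
      change _ * _ = _
      rw [H y hy h.1, H' y hy h.2, div_mul_div_comm]
      simp
    mono := by
      intro U V f hVU hf x hx
      obtain ⟨p, q, hq, H⟩ := hf x (hVU hx)
      exact ⟨p, q, hq, fun y hy => H y (hVU hy)⟩
    glue := by
      intro U f h x hx
      obtain ⟨V, hxV, hVU, hf⟩ := h x hx
      obtain ⟨p, q, hq, H⟩ := hf x hxV
      have key : ∀ W : Set X, IsOpen W → ∀ z ∈ W, ∃ r : MvPolynomial ι k,
          MvPolynomial.eval (coord z) r ≠ 0 ∧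
            ∀ y, MvPolynomial.eval (coord y) r ≠ 0 → y ∈ W := by
        intro W hW
        change TopologicalSpace.GenerateOpen _ W at hW
        induction hW with
        | basic s hs => obtain ⟨r, rfl⟩ := hs; exact fun z hz => ⟨r, hz, fun y hy => hy⟩
        | univ => exact fun z _ => ⟨1, by simp, fun _ _ => trivial⟩
        | inter s t _ _ ihs iht =>
          intro z hz
          obtain ⟨r, hr, hr'⟩ := ihs z hz.1
          obtain ⟨s, hs, hs'⟩ := iht z hz.2
          refine ⟨r * s, by simp [hr, hs], fun y hy => ?_⟩
          simp only [map_mul, ne_eq, mul_eq_zero, not_or] at hy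
          exact ⟨hr' y hy.1, hs' y hy.2⟩
        | sUnion S _ ih =>
          rintro z ⟨s, hs, hz⟩
          obtain ⟨r, hr, hr'⟩ := ih s hs z hz
          exact ⟨r, hr, fun y hy => ⟨s, hs, hr' y hy⟩⟩
      obtain ⟨r, hr, hr'⟩ := key V V.isOpen x hxV
      refine ⟨p * r, q * r, by simp [hq, hr], fun y _ h => ?_⟩
      simp only [map_mul, ne_eq, mul_eq_zero, not_or] at h
      rw [H y (hr' y h.2) h.1, map_mul, map_mul, mul_div_mul_right _ _ h.2]
    isOpen_ne_zero := by
      intro U f hf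
      rw [isOpen_iff_forall_mem_open]
      rintro x ⟨hx, hfx⟩
      obtain ⟨p, q, hq, H⟩ := hf x hx
      have hb : ∀ p : MvPolynomial ι k, IsOpen {x : X | MvPolynomial.eval (coord x) p ≠ 0} :=
        fun p => TopologicalSpace.isOpen_generateFrom_of_mem ⟨p, rfl⟩
      refine ⟨U ∩ ({y | MvPolynomial.eval (coord y) p ≠ 0} ∩
        {y | MvPolynomial.eval (coord y) q ≠ 0}), ?_,
        U.isOpen.inter ((hb p).inter (hb q)), hx, ?_, hq⟩
      · rintro y ⟨hy, hp, hq⟩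
        exact ⟨hy, by rw [H y hy hq]; exact div_ne_zero hp hq⟩
      · intro hp
        exact hfx (by rw [H x hx hq, hp, zero_div])
    inv := by
      intro U f hf h0 x hx
      obtain ⟨p, q, hq, H⟩ := hf x hx
      have hp : MvPolynomial.eval (coord x) p ≠ 0 := by
        intro hp
        exact h0 x hx (by rw [H x hx hq, hp, zero_div])
      refine ⟨q * q, p * q, by simp [hp, hq], fun y hy h => ?_⟩
      simp only [map_mul, ne_eq, mul_eq_zero, not_or] at h
      change (f y)⁻¹ = _
      rw [H y hy h.2, map_mul, map_mul, inv_div, mul_div_mul_right _ _ h.2] }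

/-- Affine space. -/
def affineSpace (k : Type) [Field k] (ι : Type) : SpaceWithFunctions k :=
  ofCoordinates (fun x : ι → k => x)

/-- The final structure on a set `X` for a family of maps from spaces with functions: a set is open
if its preimages are open, a function is regular if its pullbacks are regular. -/
def final {X α : Type} (Y : α → SpaceWithFunctions k) (φ : ∀ a, (Y a).carrier → X) :
    SpaceWithFunctions k :=
  letI : TopologicalSpace X := ⨆ a, TopologicalSpace.coinduced (φ a) (Y a).top
  have hc : ∀ a, Continuous (φ a) := fun a =>
    continuous_iff_coinduced_le.2 (le_iSup (fun a => TopologicalSpace.coinduced (φ a) (Y a).top) a)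
  { carrier := X
    RegularOn := fun U f => ∀ a, (Y a).RegularOn ⟨φ a ⁻¹' U, U.isOpen.preimage (hc a)⟩ (f ∘ φ a)
    congr := fun h hf a => (Y a).congr (fun x hx => h (φ a x) hx) (hf a)
    const := fun _ c a => (Y a).const _ c
    add := fun hf hg a => (Y a).add (hf a) (hg a)
    mul := fun hf hg a => (Y a).mul (hf a) (hg a)
    mono := fun h hf a => (Y a).mono (fun _ hx => h hx) (hf a)
    glue := by
      intro U f h a
      refine (Y a).glue fun x hx => ?_
      obtain ⟨V, hV, hVU, hf⟩ := h (φ a x) hx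
      exact ⟨⟨φ a ⁻¹' V, V.isOpen.preimage (hc a)⟩, hV, fun _ hy => hVU hy, hf a⟩
    isOpen_ne_zero := by
      intro U f hf
      rw [isOpen_iSup_iff]
      intro a
      rw [isOpen_coinduced]
      exact (Y a).isOpen_ne_zero (hf a)
    inv := fun hf h0 a => (Y a).inv (hf a) (fun x hx => h0 (φ a x) hx) }

/-- The quotient by a group action: the set of orbits with the quotient topology and the sheaf of
invariant regular functions. -/
def quotient (X : SpaceWithFunctions k) (G : Type) [Group G] [MulAction G X.carrier] :
    SpaceWithFunctions k :=
  final (X := MulAction.orbitRel.Quotient G X.carrier) (fun _ : Unit => X)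
    (fun _ x => Quotient.mk _ x)

end SpaceWithFunctions

/-- The vector space `End(ℂ^c)^{n+2} ⊕ Hom(ℂ^c, ℂ)`; the matrix `C_q` is `C (q - 1)`. -/
@[ext]
structure ADHMData (n c : ℕ) where
  A₁ : Matrix (Fin c) (Fin c) ℂ
  A₂ : Matrix (Fin c) (Fin c) ℂ
  C : Fin n → Matrix (Fin c) (Fin c) ℂ
  e : Fin c → ℂ

namespace ADHMData

variable {n c : ℕ}

/-- The linear coordinates (matrix entries). -/
def coord (x : ADHMData n c) :
    (Fin c × Fin c) ⊕ (Fin c × Fin c) ⊕ (Fin n × Fin c × Fin c) ⊕ Fin c → ℂ :=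
  Sum.elim (fun i => x.A₁ i.1 i.2) (Sum.elim (fun i => x.A₂ i.1 i.2)
    (Sum.elim (fun i => x.C i.1 i.2.1 i.2.2) x.e))

/-- `(φ₁, φ₂)` acts by `A_i ↦ φ₂ A_i φ₁⁻¹`, `C_j ↦ φ₁ C_j φ₂⁻¹`, `e ↦ e φ₁⁻¹`. -/
instance : MulAction (GL (Fin c) ℂ × GL (Fin c) ℂ) (ADHMData n c) where
  smul φ x :=
    { A₁ := φ.2.val * x.A₁ * φ.1⁻¹.val
      A₂ := φ.2.val * x.A₂ * φ.1⁻¹.val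
      C := fun j => φ.1.val * x.C j * φ.2⁻¹.val
      e := Matrix.vecMul x.e φ.1⁻¹.val }
  one_smul x := by
    change ADHMData.mk _ _ _ _ = x
    ext : 1 <;> simp
  mul_smul φ ψ x := by
    change ADHMData.mk _ _ _ _ = ADHMData.mk _ _ _ _
    ext : 1 <;>
      simp only [HSMul.hSMul, Prod.fst_mul, Prod.snd_mul, mul_inv_rev, Units.val_mul,
        Matrix.vecMul_vecMul, mul_assoc]

/-- The relations between the matrices `A_i` and `C_q`. -/
def P1 [NeZero n] (x : ADHMData n c) : Prop :=
  (n = 1 → x.A₁ * x.C 0 * x.A₂ = x.A₂ * x.C 0 * x.A₁) ∧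
  (1 < n → ∀ (q : ℕ) (hq : q + 1 < n),
    x.A₁ * x.C ⟨q, Nat.lt_of_succ_lt hq⟩ = x.A₂ * x.C ⟨q + 1, hq⟩ ∧
    x.C ⟨q, Nat.lt_of_succ_lt hq⟩ * x.A₁ = x.C ⟨q + 1, hq⟩ * x.A₂)

/-- Regularity of the pencil spanned by `A_1` and `A_2`. -/
def P2 (x : ADHMData n c) : Prop :=
  ∃ ν₁ ν₂ : ℂ, (ν₁, ν₂) ≠ (0, 0) ∧ (ν₁ • x.A₁ + ν₂ • x.A₂).det ≠ 0

/-- The stability condition; `(l₁, l₂)` are homogeneous coordinates of a point of `ℙ¹`. -/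
def P3 [NeZero n] (x : ADHMData n c) : Prop :=
  ∀ l₁ l₂ μ₁ μ₂ : ℂ, (l₁, l₂) ≠ (0, 0) → l₁ ^ n * μ₁ + l₂ ^ n * μ₂ = 0 →
    ¬ ∃ v : Fin c → ℂ, v ≠ 0 ∧
      (l₂ • x.A₁ + l₁ • x.A₂).mulVec v = 0 ∧
      (x.C 0 * x.A₂ + μ₁ • (1 : Matrix (Fin c) (Fin c) ℂ)).mulVec v = 0 ∧
      (x.C ⟨n - 1, Nat.sub_one_lt (NeZero.ne n)⟩ * x.A₁ +
        ((-1) ^ (n - 1) * μ₂) • (1 : Matrix (Fin c) (Fin c) ℂ)).mulVec v = 0 ∧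
      x.e ⬝ᵥ v = 0

end ADHMData

/-- The set `P^n(c)`, with its action of `GL(c, ℂ) × GL(c, ℂ)`. -/
def ADHMVariety (n c : ℕ) [NeZero n] :
    SubMulAction (GL (Fin c) ℂ × GL (Fin c) ℂ) (ADHMData n c) where
  carrier := {x | x.P1 ∧ x.P2 ∧ x.P3}
  smul_mem' := by
    rintro φ x ⟨⟨h1, h1'⟩, ⟨ν₁, ν₂, hν, h2⟩, h3⟩
    have e1 (M N : Matrix (Fin c) (Fin c) ℂ) :
        (φ.2.val * M * φ.1⁻¹.val) * (φ.1.val * N * φ.2⁻¹.val) = φ.2.val * (M * N) * φ.2⁻¹.val := by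
      simp only [mul_assoc, Units.inv_mul_cancel_left]
    have e2 (M N : Matrix (Fin c) (Fin c) ℂ) :
        (φ.1.val * M * φ.2⁻¹.val) * (φ.2.val * N * φ.1⁻¹.val) = φ.1.val * (M * N) * φ.1⁻¹.val := by
      simp only [mul_assoc, Units.inv_mul_cancel_left]
    have e3 (M N : Matrix (Fin c) (Fin c) ℂ) :
        (φ.2.val * M * φ.2⁻¹.val) * (φ.2.val * N * φ.1⁻¹.val) = φ.2.val * (M * N) * φ.1⁻¹.val := by
      simp only [mul_assoc, Units.inv_mul_cancel_left]
    refine ⟨⟨fun hn => ?_, fun hn q hq => ⟨?_, ?_⟩⟩, ⟨ν₁, ν₂, hν, ?_⟩, ?_⟩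
    · change (φ.2.val * x.A₁ * φ.1⁻¹.val) * (φ.1.val * x.C 0 * φ.2⁻¹.val) *
          (φ.2.val * x.A₂ * φ.1⁻¹.val) = (φ.2.val * x.A₂ * φ.1⁻¹.val) *
          (φ.1.val * x.C 0 * φ.2⁻¹.val) * (φ.2.val * x.A₁ * φ.1⁻¹.val)
      rw [e1, e1, e3, e3, h1 hn]
    · exact (e1 _ _).trans ((congrArg (fun M => φ.2.val * M * φ.2⁻¹.val) (h1' hn q hq).1).trans (e1 _ _).symm)
    · exact (e2 _ _).trans ((congrArg (fun M => φ.1.val * M * φ.1⁻¹.val) (h1' hn q hq).2).trans (e2 _ _).symm)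
    · change (ν₁ • (φ.2.val * x.A₁ * φ.1⁻¹.val) + ν₂ • (φ.2.val * x.A₂ * φ.1⁻¹.val)).det ≠ 0
      have : ν₁ • (φ.2.val * x.A₁ * φ.1⁻¹.val) + ν₂ • (φ.2.val * x.A₂ * φ.1⁻¹.val) =
          φ.2.val * (ν₁ • x.A₁ + ν₂ • x.A₂) * φ.1⁻¹.val := by
        simp [mul_add, add_mul]
      rw [this, Matrix.det_mul, Matrix.det_mul]
      exact mul_ne_zero (mul_ne_zero ((Matrix.isUnit_iff_isUnit_det _).1 φ.2.isUnit).ne_zero h2)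
        ((Matrix.isUnit_iff_isUnit_det _).1 φ.1⁻¹.isUnit).ne_zero
    · rintro l₁ l₂ μ₁ μ₂ hl hlμ ⟨v, hv, a, b, d, f⟩
      have inj (u : GL (Fin c) ℂ) (w : Fin c → ℂ) (h : u.val.mulVec w = 0) : w = 0 := by
        have := congrArg (u⁻¹.val.mulVec) h
        simpa [Matrix.mulVec_mulVec, -Matrix.coe_units_inv] using this
      refine h3 l₁ l₂ μ₁ μ₂ hl hlμ ⟨φ.1⁻¹.val.mulVec v, fun h => hv (inj _ _ h), ?_, ?_, ?_, ?_⟩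
      · apply inj φ.2
        rw [← a, Matrix.mulVec_mulVec, Matrix.mulVec_mulVec]
        congr 1
        change _ = l₂ • (φ.2.val * x.A₁ * φ.1⁻¹.val) + l₁ • (φ.2.val * x.A₂ * φ.1⁻¹.val)
        simp [mul_add, add_mul, mul_assoc, -Matrix.coe_units_inv]
      · apply inj φ.1
        rw [← b, Matrix.mulVec_mulVec, Matrix.mulVec_mulVec]
        congr 1
        refine Eq.trans ?_ (congrArg (· + _) (e2 _ _).symm)
        simp [mul_add, add_mul, mul_assoc, -Matrix.coe_units_inv]
      · apply inj φ.1
        rw [← d, Matrix.mulVec_mulVec, Matrix.mulVec_mulVec]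
        congr 1
        refine Eq.trans ?_ (congrArg (· + _) (e2 _ _).symm)
        simp [mul_add, add_mul, mul_assoc, -Matrix.coe_units_inv]
      · rw [Matrix.dotProduct_mulVec]
        exact f

/-- `P^n(c)` as a quasi-affine variety in `End(ℂ^c)^{n+2} ⊕ Hom(ℂ^c, ℂ)`. -/
def ADHMSpace (n c : ℕ) [NeZero n] : SpaceWithFunctions ℂ :=
  SpaceWithFunctions.ofCoordinates (fun x : ADHMVariety n c => x.val.coord)

instance (n c : ℕ) [NeZero n] :
    MulAction (GL (Fin c) ℂ × GL (Fin c) ℂ) (ADHMSpace n c).carrier :=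
  inferInstanceAs (MulAction (GL (Fin c) ℂ × GL (Fin c) ℂ) (ADHMVariety n c))

/-- The points of the total space of `O(-n)` over the projective line `ℙ¹` of lines in `ℂ²`. As
`O(-1)` is the tautological line bundle and `O(-n)` its `n`-th tensor power, the fibre over a line
`ℓ` is `ℓ^{⊗ n}`. -/
structure TotO (n : ℕ) where
  base : ℙ ℂ (Fin 2 → ℂ)
  vec : ⨂[ℂ]^n base.submodule

namespace TotO

/-- The vectors `(1, t)` and `(t, 1)`, which represent the points of the two standard affine charts
of `ℙ¹`. -/
def frame (i : Fin 2) (t : ℂ) : Fin 2 → ℂ :=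
  if i = 0 then ![1, t] else ![t, 1]

theorem frame_ne_zero (i : Fin 2) (t : ℂ) : frame i t ≠ 0 := by
  intro h
  have h0 := congrFun h 0
  have h1 := congrFun h 1
  unfold frame at h0 h1
  split_ifs at h0 h1 <;> simp at h0 h1

theorem frame_mem (i : Fin 2) (t : ℂ) :
    frame i t ∈ (Projectivization.mk ℂ (frame i t) (frame_ne_zero i t)).submodule := by
  rw [Projectivization.submodule_mk]
  exact Submodule.mem_span_singleton_self _

/-- The standard trivialization of `O(-n)` over the `i`-th affine chart of `ℙ¹`, in the local frame
`(1, t)^{⊗ n}` or `(t, 1)^{⊗ n}`: the pair `(t, s)` is sent to `s` times this frame. -/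
def chart (n : ℕ) (i : Fin 2) (z : Fin 2 → ℂ) : TotO n where
  base := Projectivization.mk ℂ (frame i (z 0)) (frame_ne_zero i (z 0))
  vec := z 1 • PiTensorProduct.tprod ℂ (fun _ : Fin n => ⟨frame i (z 0), frame_mem i (z 0)⟩)

/-- `Tot(O_{ℙ¹}(-n))` as a variety, glued from its two standard trivializations. -/
def space (n : ℕ) : SpaceWithFunctions ℂ :=
  SpaceWithFunctions.final (fun _ : Fin 2 => SpaceWithFunctions.affineSpace ℂ (Fin 2)) (chart n)

end TotO

end

/-! For `c = 1` a datum is a tuple of scalars (a₁, a₂; γ₁, …, γₙ; ε). Condition (P2) says (a₁, a₂) ≠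
0. Condition (P1) gives a₁γ_q = a₂γ_{q+1}, so all γ's are determined by γₙ where a₁ ≠ 0 and by γ₁
where a₂ ≠ 0. Given these, (P3) amounts to ε ≠ 0 (`e_ne_zero`, `ofScalars_mem`). The torus can
therefore normalise ε and a nonzero a_i to 1 (`exists_smul_eq_ofInvariants`). The orbits with a₁ ≠ 0
form a plane with coordinates t = a₂/a₁, s = γₙa₁; those with a₂ ≠ 0 form a plane with coordinates
a₁/a₂, γ₁a₂. By (P1), γ₁a₂ = s·tⁿ on the overlap, which is the transition function of O(-n)
(`chart_zero_eq_chart_one`, `toTotO_eq_chart`). The resulting bijection is regular because the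
invariants are; its inverse is regular because on each chart it is the polynomial normal form
followed by the quotient map. -/

/-! ### Morphisms of spaces with functions -/

namespace SpaceWithFunctions

variable {k : Type} [Field k]

/-- A map that restricts to a morphism on the open set `U`. -/
structure IsMorphismOn (X Y : SpaceWithFunctions k) (U : TopologicalSpace.Opens X.carrier)
    (φ : X.carrier → Y.carrier) : Prop where
  continuousOn : ContinuousOn φ U
  regularOn_comp : ∀ (V : TopologicalSpace.Opens Y.carrier) (f : Y.carrier → k),
    Y.RegularOn V f → ∀ W ≤ U, (∀ x ∈ W, φ x ∈ V) → X.RegularOn W (f ∘ φ)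

theorem IsMorphismOn.congr {X Y : SpaceWithFunctions k} {U : TopologicalSpace.Opens X.carrier}
    {φ ψ : X.carrier → Y.carrier} (h : IsMorphismOn X Y U φ) (hφ : ∀ x ∈ U, φ x = ψ x) :
    IsMorphismOn X Y U ψ where
  continuousOn := h.continuousOn.congr fun x hx => (hφ x hx).symm
  regularOn_comp V f hf W hW hWV :=
    X.congr (fun x hx => congrArg f (hφ x (hW hx)))
      (h.regularOn_comp V f hf W hW fun x hx => by rw [hφ x (hW hx)]; exact hWV x hx)

theorem IsMorphism.comp_isMorphismOn {X Y Z : SpaceWithFunctions k}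
    {U : TopologicalSpace.Opens X.carrier} {ψ : Y.carrier → Z.carrier} {φ : X.carrier → Y.carrier}
    (hψ : IsMorphism Y Z ψ) (hφ : IsMorphismOn X Y U φ) : IsMorphismOn X Z U (ψ ∘ φ) where
  continuousOn := hψ.continuous.comp_continuousOn hφ.continuousOn
  regularOn_comp V f hf W hW hWV :=
    hφ.regularOn_comp _ _ (hψ.regularOn_comp V f hf) W hW hWV

theorem IsMorphism.comp {X Y Z : SpaceWithFunctions k} {ψ : Y.carrier → Z.carrier}
    {φ : X.carrier → Y.carrier} (hψ : IsMorphism Y Z ψ) (hφ : IsMorphism X Y φ) :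
    IsMorphism X Z (ψ ∘ φ) where
  continuous := hψ.continuous.comp hφ.continuous
  regularOn_comp V f hf := hφ.regularOn_comp _ _ (hψ.regularOn_comp V f hf)

/-- Being a morphism is local on the source. -/
theorem isMorphism_of_forall_exists_isMorphismOn {X Y : SpaceWithFunctions k}
    {φ : X.carrier → Y.carrier} (h : ∀ x, ∃ U, x ∈ U ∧ IsMorphismOn X Y U φ) :
    IsMorphism X Y φ := by
  have hc : Continuous φ := continuous_iff_continuousAt.2 fun x => by
    obtain ⟨U, hx, hU⟩ := h x
    exact hU.continuousOn.continuousAt (U.isOpen.mem_nhds hx)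
  refine ⟨hc, fun V f hf => X.glue fun x hx => ?_⟩
  obtain ⟨U, hxU, hU⟩ := h x
  exact ⟨⟨φ ⁻¹' V, V.isOpen.preimage hc⟩ ⊓ U, ⟨hx, hxU⟩, inf_le_left,
    hU.regularOn_comp V f hf _ inf_le_right fun y hy => hy.1⟩

theorem regularOn_eval (X : SpaceWithFunctions k) {ι : Type}
    {U : TopologicalSpace.Opens X.carrier} {g : X.carrier → ι → k}
    (hg : ∀ i, X.RegularOn U fun x => g x i) (p : MvPolynomial ι k) :
    X.RegularOn U fun x => MvPolynomial.eval (g x) p := by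
  induction p using MvPolynomial.induction_on with
  | C a => simpa using X.const U a
  | add p q hp hq => simpa using X.add hp hq
  | mul_X p i hp => simpa using X.mul hp (hg i)

/-- A map into a subset of affine space is a morphism where its coordinates are regular. -/
theorem isMorphismOn_ofCoordinates {X : SpaceWithFunctions k} {Y ι : Type} {coord : Y → ι → k}
    {U : TopologicalSpace.Opens X.carrier} {g : X.carrier → Y}
    (hg : ∀ i, X.RegularOn U fun x => coord (g x) i) :
    IsMorphismOn X (ofCoordinates coord) U g where
  continuousOn := by
    refine continuousOn_to_generateFrom_iff.2 ?_
    rintro x hx _ ⟨p, rfl⟩ hp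
    exact mem_nhdsWithin_of_mem_nhds (Filter.mem_of_superset
      ((X.isOpen_ne_zero (X.regularOn_eval hg p)).mem_nhds ⟨hx, hp⟩) fun y hy => hy.2)
  regularOn_comp V f hf W hW hWV := by
    refine X.glue fun x hx => ?_
    obtain ⟨p, q, hq, H⟩ := hf (g x) (hWV x hx)
    have hr (r : MvPolynomial ι k) := X.mono hW (X.regularOn_eval hg r)
    -- On the open set where the denominator does not vanish, `f ∘ g` is an honest quotient of
    -- regular functions.
    let W' : TopologicalSpace.Opens X.carrier := ⟨_, X.isOpen_ne_zero (hr q)⟩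
    have hW' : W' ≤ W := fun y hy => hy.1
    refine ⟨W', ⟨hx, hq⟩, hW', ?_⟩
    refine X.congr (fun y hy => ?_)
      (X.mul (X.mono hW' (hr p)) (X.inv (X.mono hW' (hr q)) fun y hy => hy.2))
    exact ((H (g y) (hWV y hy.1) hy.2).trans (div_eq_mul_inv _ _)).symm

theorem isMorphism_ofCoordinates {X : SpaceWithFunctions k} {Y ι : Type} {coord : Y → ι → k}
    {g : X.carrier → Y} (hg : ∀ i, X.RegularOn ⊤ fun x => coord (g x) i) :
    IsMorphism X (ofCoordinates coord) g :=
  isMorphism_of_forall_exists_isMorphismOn fun _ =>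
    ⟨⊤, trivial, isMorphismOn_ofCoordinates hg⟩

theorem regularOn_coord {X ι : Type} (coord : X → ι → k)
    (U : TopologicalSpace.Opens (ofCoordinates coord).carrier) (i : ι) :
    (ofCoordinates coord).RegularOn U fun x => coord x i :=
  fun _ _ => ⟨MvPolynomial.X i, 1, by simp, fun _ _ _ => by simp⟩

theorem isMorphism_final {X α : Type} (Y : α → SpaceWithFunctions k)
    (φ : ∀ a, (Y a).carrier → X) (a : α) : IsMorphism (Y a) (final Y φ) (φ a) where
  continuous := continuous_iff_coinduced_le.2
    (le_iSup (fun a => TopologicalSpace.coinduced (φ a) (Y a).top) a)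
  regularOn_comp _ _ hf := hf a

/-- Universal property of the final structure; it serves both the orbit space and the space glued
from two charts. -/
theorem isMorphism_of_comp_final {X α : Type} {Y : α → SpaceWithFunctions k}
    {φ : ∀ a, (Y a).carrier → X} {Z : SpaceWithFunctions k} {ψ : X → Z.carrier}
    (h : ∀ a, IsMorphism (Y a) Z (ψ ∘ φ a)) : IsMorphism (final Y φ) Z ψ where
  continuous := continuous_iSup_dom.2 fun a => continuous_coinduced_dom.2 (h a).continuous
  regularOn_comp V f hf a := (h a).regularOn_comp V f hf

end SpaceWithFunctions

/-! ### Charts of the total space of O(-n) -/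

namespace TotO

variable {n : ℕ}

/-- Keeping `b` and `b'` as variables allows `subst`, which avoids transporting tensors between
fibres. The factor `c ^ n` is the homogeneity of the `n`-fold tensor power. -/
theorem mk_smul_tprod_eq {b b' : ℙ ℂ (Fin 2 → ℂ)} (h : b = b') (s c : ℂ) (u : b.submodule)
    (u' : b'.submodule) (hu : (u : Fin 2 → ℂ) = c • (u' : Fin 2 → ℂ)) :
    (⟨b, s • PiTensorProduct.tprod ℂ fun _ : Fin n => u⟩ : TotO n) =
      ⟨b', (s * c ^ n) • PiTensorProduct.tprod ℂ fun _ : Fin n => u'⟩ := by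
  subst h
  obtain rfl : u = c • u' := Subtype.ext hu
  have := (PiTensorProduct.tprod ℂ).map_smul_univ (fun _ : Fin n => c) (fun _ => u')
  rw [this]
  simp [smul_smul]

/-- The transition function between the two standard trivializations. -/
theorem chart_zero_eq_chart_one {t : ℂ} (ht : t ≠ 0) (s : ℂ) :
    chart n 0 ![t, s] = chart n 1 ![t⁻¹, s * t ^ n] := by
  have h : frame 0 t = t • frame 1 t⁻¹ := by
    ext j; fin_cases j <;> simp [frame, ht]
  refine mk_smul_tprod_eq ?_ s t _ _ h
  exact (Projectivization.mk_eq_mk_iff' _ _ _ _ _).2 ⟨t, h.symm⟩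

/-- The value at a point of the linear functional on the fibre that is the `n`-th power of the `i`-th coordinate. -/
noncomputable def fibreCoord (i : Fin 2) (w : TotO n) : ℂ :=
  PiTensorProduct.lift ((MultilinearMap.mkPiAlgebra ℂ (Fin n) ℂ).compLinearMap
    fun _ => (LinearMap.proj i).comp w.base.submodule.subtype) w.vec

theorem fibreCoord_chart (i : Fin 2) (z : Fin 2 → ℂ) : fibreCoord i (chart n i z) = z 1 := by
  have h : frame i (z 0) i = 1 := by fin_cases i <;> simp [frame]
  let b : ℙ ℂ (Fin 2 → ℂ) := Projectivization.mk ℂ (frame i (z 0)) (frame_ne_zero i (z 0))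
  let u : b.submodule := ⟨frame i (z 0), frame_mem i (z 0)⟩
  change PiTensorProduct.lift ((MultilinearMap.mkPiAlgebra ℂ (Fin n) ℂ).compLinearMap
    fun _ => (LinearMap.proj i).comp b.submodule.subtype)
      (z 1 • PiTensorProduct.tprod ℂ fun _ => u) = z 1
  rw [map_smul, PiTensorProduct.lift.tprod]
  simp [u, h]

/-- The base point determines t. Since `fibreCoord` is defined on the whole total space, s is
recovered without comparing tensors in different fibres. -/
theorem chart_injective (i : Fin 2) : Function.Injective (chart n i) := by
  intro z z' h
  have h1 : z 1 = z' 1 := by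
    simpa only [fibreCoord_chart] using congrArg (fibreCoord i) h
  obtain ⟨a, ha⟩ := (Projectivization.mk_eq_mk_iff' _ _ _ _ _).1 (congrArg TotO.base h)
  have e0 := congrFun ha 0
  have e1 := congrFun ha 1
  ext j
  fin_cases j
  · fin_cases i
    · simp [frame] at e0 e1
      simp [← e1, e0]
    · simp [frame] at e0 e1
      simp [← e0, e1]
  · exact h1

/-- Tensor powers of a line are lines: by multilinearity the scalars come out of each pure tensor.
-/
theorem exists_smul_tprod_eq {V : Submodule ℂ (Fin 2 → ℂ)} (u : V)
    (hu : ∀ v : V, ∃ c : ℂ, v = c • u) (w : ⨂[ℂ]^n V) :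
    ∃ s : ℂ, w = s • PiTensorProduct.tprod ℂ fun _ : Fin n => u := by
  induction w using PiTensorProduct.induction_on with
  | smul_tprod r f =>
    choose c hc using fun j => hu (f j)
    refine ⟨r * ∏ j, c j, ?_⟩
    rw [mul_smul, ← MultilinearMap.map_smul_univ]
    simp only [← hc]
  | add x y hx hy =>
    obtain ⟨s, rfl⟩ := hx
    obtain ⟨s', rfl⟩ := hy
    exact ⟨s + s', (add_smul _ _ _).symm⟩

theorem exists_mk_frame_eq (b : ℙ ℂ (Fin 2 → ℂ)) :
    ∃ i t, b = Projectivization.mk ℂ (frame i t) (frame_ne_zero i t) := by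
  induction b using Projectivization.ind with
  | h v hv =>
    by_cases h0 : v 0 = 0
    · have h1 : v 1 ≠ 0 := fun h1 => hv (by ext j; fin_cases j <;> simp [h0, h1])
      refine ⟨1, v 0 / v 1, (Projectivization.mk_eq_mk_iff' _ _ _ _ _).2 ⟨v 1, ?_⟩⟩
      ext j; fin_cases j <;> simp [frame, h0]
    · refine ⟨0, v 1 / v 0, (Projectivization.mk_eq_mk_iff' _ _ _ _ _).2 ⟨v 0, ?_⟩⟩
      ext j; fin_cases j <;> simp [frame, mul_div_cancel₀, h0]

theorem exists_chart_eq (w : TotO n) : ∃ i z, chart n i z = w := by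
  obtain ⟨b, w⟩ := w
  obtain ⟨i, t, rfl⟩ := exists_mk_frame_eq b
  obtain ⟨s, rfl⟩ := exists_smul_tprod_eq ⟨frame i t, frame_mem i t⟩ (fun v => by
    obtain ⟨c, hc⟩ := Submodule.mem_span_singleton.1 ((Projectivization.submodule_mk _ _).le v.2)
    exact ⟨c, Subtype.ext hc.symm⟩) w
  exact ⟨i, ![t, s], rfl⟩

end TotO

/-! ### Data with c = 1: stability, invariants and normal forms -/

namespace ADHMData

variable {n : ℕ}

/-- The datum with `c = 1` that has the given scalars as entries. -/
def ofScalars (a₁ a₂ : ℂ) (γ : Fin n → ℂ) (ε : ℂ) : ADHMData n 1 :=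
  ⟨.of fun _ _ => a₁, .of fun _ _ => a₂, fun q => .of fun _ _ => γ q, fun _ => ε⟩

theorem ofScalars_mem [NeZero n] {a₁ a₂ : ℂ} {γ : Fin n → ℂ} {ε : ℂ}
    (h1 : ∀ (q : ℕ) (hq : q + 1 < n),
      a₁ * γ ⟨q, Nat.lt_of_succ_lt hq⟩ = a₂ * γ ⟨q + 1, hq⟩)
    (h2 : a₁ ≠ 0 ∨ a₂ ≠ 0) (h3 : ε ≠ 0) : ofScalars a₁ a₂ γ ε ∈ ADHMVariety n 1 := by
  refine ⟨⟨fun _ => ?_, fun _ q hq => ⟨?_, ?_⟩⟩, ?_, ?_⟩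
  · ext i j
    simp [Matrix.mul_apply, ofScalars]
    ring
  · ext i j
    simpa [Matrix.mul_apply, ofScalars] using h1 q hq
  · ext i j
    simpa [Matrix.mul_apply, ofScalars, mul_comm] using h1 q hq
  · rcases h2 with h | h
    · exact ⟨1, 0, by simp, by simpa [ofScalars] using h⟩
    · exact ⟨0, 1, by simp, by simpa [ofScalars] using h⟩
  -- In dimension one, `e v = 0` with `e ≠ 0` already forces `v = 0`.
  · rintro l₁ l₂ μ₁ μ₂ - - ⟨v, hv, -, -, -, h⟩
    refine hv ?_
    ext j
    simpa [dotProduct, ofScalars, h3, Subsingleton.elim j 0] using h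

variable {x : ADHMData n 1}

theorem P1.apply_mul_apply [NeZero n] (h : x.P1) (q : ℕ) (hq : q + 1 < n) :
    x.A₁ 0 0 * x.C ⟨q, Nat.lt_of_succ_lt hq⟩ 0 0 = x.A₂ 0 0 * x.C ⟨q + 1, hq⟩ 0 0 := by
  have := congrFun (congrFun (h.2 (by omega) q hq).1 0) 0
  simpa [Matrix.mul_apply] using this

theorem P1.pow_mul_apply [NeZero n] (h : x.P1) (q m : ℕ) (hq : q + m < n) :
    x.A₁ 0 0 ^ m * x.C ⟨q, by omega⟩ 0 0 = x.A₂ 0 0 ^ m * x.C ⟨q + m, hq⟩ 0 0 := by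
  induction m with
  | zero => simp
  | succ m ih =>
    have h' := h.apply_mul_apply (q + m) hq
    rw [pow_succ', mul_assoc, ih (by omega), mul_left_comm, h', ← mul_assoc, ← pow_succ]
    rfl

theorem P2.apply_ne_zero (h : x.P2) : x.A₁ 0 0 ≠ 0 ∨ x.A₂ 0 0 ≠ 0 := by
  obtain ⟨ν₁, ν₂, -, hd⟩ := h
  by_contra! h0
  exact hd (by simp [h0])

theorem e_ne_zero [NeZero n] (h1 : x.P1) (h2 : x.P2) (h3 : x.P3) : x.e 0 ≠ 0 := by
  intro he
  -- With `v = 1`, the three matrix equations are solved by λ = (a₁, -a₂), μ₁ = -γ₁a₂, μ₂ =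
  -- (-1)ⁿγₙa₁. The constraint λ₁ⁿμ₁ + λ₂ⁿμ₂ = 0 is then -a₁a₂ times the relation a₁ⁿ⁻¹γ₁ = a₂ⁿ⁻¹γₙ.
  refine h3 (x.A₁ 0 0) (-x.A₂ 0 0) (-(x.C 0 0 0 * x.A₂ 0 0))
    ((-1) ^ n * (x.C ⟨n - 1, Nat.sub_one_lt (NeZero.ne n)⟩ 0 0 * x.A₁ 0 0)) ?_ ?_
    ⟨1, one_ne_zero, ?_, ?_, ?_, ?_⟩
  · rcases h2.apply_ne_zero with h | h <;> simp [h]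
  · have h := h1.pow_mul_apply 0 (n - 1) (by have := NeZero.pos n; omega)
    obtain ⟨m, rfl⟩ : ∃ m, n = m + 1 := ⟨n - 1, by have := NeZero.pos n; omega⟩
    simp only [Nat.add_sub_cancel, zero_add] at h ⊢
    change _ * x.C 0 0 0 = _ at h
    have hs : ((-1 : ℂ) ^ (m + 1)) * (-1) ^ (m + 1) = 1 := by
      rw [← mul_pow]; simp
    rw [neg_pow (x.A₂ 0 0)]
    linear_combination (-x.A₁ 0 0 * x.A₂ 0 0) * h +
      x.A₂ 0 0 ^ (m + 1) * x.C ⟨m, by omega⟩ 0 0 * x.A₁ 0 0 * hs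
  · ext j
    simp [Matrix.mulVec, dotProduct, Subsingleton.elim j 0]
    ring
  · ext j
    simp [Matrix.mulVec, dotProduct, Matrix.mul_apply, Subsingleton.elim j 0]
  · ext j
    have hs : ((-1 : ℂ) ^ (n - 1)) * (-1) ^ n = -1 := by
      rw [← pow_add, Odd.neg_one_pow]
      have := NeZero.pos n
      exact ⟨n - 1, by omega⟩
    simp [Matrix.mulVec, dotProduct, Matrix.mul_apply, Subsingleton.elim j 0]
    rw [← mul_assoc, hs]
    ring
  · simp [dotProduct, he]

/-- The affine coordinates of the orbit of a datum with `A₁ ≠ 0` (if `i = 0`) or `A₂ ≠ 0`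
(if `i = 1`), in the corresponding chart of the total space. -/
noncomputable def invariants [NeZero n] (i : Fin 2) (x : ADHMData n 1) : Fin 2 → ℂ :=
  if i = 0 then ![x.A₂ 0 0 / x.A₁ 0 0,
    x.C ⟨n - 1, Nat.sub_one_lt (NeZero.ne n)⟩ 0 0 * x.A₁ 0 0]
  else ![x.A₁ 0 0 / x.A₂ 0 0, x.C 0 0 0 * x.A₂ 0 0]

/-- The scalar that is inverted on the `i`-th chart. -/
def pivot (i : Fin 2) (x : ADHMData n 1) : ℂ :=
  if i = 0 then x.A₁ 0 0 else x.A₂ 0 0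

/-- The datum with given affine coordinates in the `i`-th chart. -/
def ofInvariants (n : ℕ) (i : Fin 2) (z : Fin 2 → ℂ) : ADHMData n 1 :=
  if i = 0 then ofScalars 1 (z 0) (fun q => z 1 * z 0 ^ (n - 1 - q : ℕ)) 1
  else ofScalars (z 0) 1 (fun q => z 1 * z 0 ^ (q : ℕ)) 1

theorem ofInvariants_mem [NeZero n] (i : Fin 2) (z : Fin 2 → ℂ) :
    ofInvariants n i z ∈ ADHMVariety n 1 := by
  unfold ofInvariants
  split_ifs
  · refine ofScalars_mem (fun q hq => ?_) (by simp) one_ne_zero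
    -- This removes the truncated subtractions: the two exponents become `m + 1` and `m`.
    obtain ⟨m, rfl⟩ : ∃ m, n = q + 2 + m := ⟨n - (q + 2), by omega⟩
    have h1 : q + 2 + m - 1 - q = m + 1 := by omega
    have h2 : q + 2 + m - 1 - (q + 1) = m := by omega
    simp only [h1, h2]
    ring
  · refine ofScalars_mem (fun q hq => ?_) (by simp) one_ne_zero
    ring

theorem pivot_ofInvariants (i : Fin 2) (z : Fin 2 → ℂ) : pivot i (ofInvariants n i z) = 1 := by
  fin_cases i <;> simp [pivot, ofInvariants, ofScalars]

theorem invariants_ofInvariants [NeZero n] (i : Fin 2) (z : Fin 2 → ℂ) :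
    invariants i (ofInvariants n i z) = z := by
  ext j
  fin_cases i <;> fin_cases j <;> simp [invariants, ofInvariants, ofScalars]

theorem smul_A₁_apply (φ : GL (Fin 1) ℂ × GL (Fin 1) ℂ) :
    (φ • x).A₁ 0 0 = φ.2.val 0 0 * x.A₁ 0 0 * (φ.1.val 0 0)⁻¹ := by
  change (φ.2.val * x.A₁ * φ.1⁻¹.val) 0 0 = _
  simp [Matrix.mul_apply]

theorem smul_A₂_apply (φ : GL (Fin 1) ℂ × GL (Fin 1) ℂ) :
    (φ • x).A₂ 0 0 = φ.2.val 0 0 * x.A₂ 0 0 * (φ.1.val 0 0)⁻¹ := by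
  change (φ.2.val * x.A₂ * φ.1⁻¹.val) 0 0 = _
  simp [Matrix.mul_apply]

theorem smul_C_apply (φ : GL (Fin 1) ℂ × GL (Fin 1) ℂ) (q : Fin n) :
    (φ • x).C q 0 0 = φ.1.val 0 0 * x.C q 0 0 * (φ.2.val 0 0)⁻¹ := by
  change (φ.1.val * x.C q * φ.2⁻¹.val) 0 0 = _
  simp [Matrix.mul_apply]

theorem smul_e_apply (φ : GL (Fin 1) ℂ × GL (Fin 1) ℂ) :
    (φ • x).e 0 = x.e 0 * (φ.1.val 0 0)⁻¹ := by
  change Matrix.vecMul x.e φ.1⁻¹.val 0 = _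
  simp [Matrix.vecMul, dotProduct]

theorem gl_one_apply_ne_zero (g : GL (Fin 1) ℂ) : g.val 0 0 ≠ 0 := by
  have := ((Matrix.isUnit_iff_isUnit_det _).1 g.isUnit).ne_zero
  simpa using this

theorem exists_gl_one_apply_eq {a : ℂ} (ha : a ≠ 0) : ∃ g : GL (Fin 1) ℂ, g.val 0 0 = a :=
  ⟨Matrix.GeneralLinearGroup.mkOfDetNeZero (.of fun _ _ => a) (by simpa using ha), rfl⟩

theorem ext_apply {x y : ADHMData n 1} (h₁ : x.A₁ 0 0 = y.A₁ 0 0) (h₂ : x.A₂ 0 0 = y.A₂ 0 0)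
    (hC : ∀ q, x.C q 0 0 = y.C q 0 0) (he : x.e 0 = y.e 0) : x = y := by
  ext i j
  · simpa [Subsingleton.elim i 0, Subsingleton.elim j 0] using h₁
  · simpa [Subsingleton.elim i 0, Subsingleton.elim j 0] using h₂
  · rename_i k
    simpa [Subsingleton.elim j 0, Subsingleton.elim k 0] using hC i
  · simpa [Subsingleton.elim i 0] using he

theorem pivot_smul_ne_zero (i : Fin 2) (φ : GL (Fin 1) ℂ × GL (Fin 1) ℂ) :
    pivot i (φ • x) ≠ 0 ↔ pivot i x ≠ 0 := by
  have h1 := gl_one_apply_ne_zero φ.1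
  have h2 := gl_one_apply_ne_zero φ.2
  simp only [pivot, smul_A₁_apply, smul_A₂_apply]
  split_ifs <;> simp [h1, h2]

theorem invariants_smul [NeZero n] (i : Fin 2) (φ : GL (Fin 1) ℂ × GL (Fin 1) ℂ) :
    invariants i (φ • x) = invariants i x := by
  have h1 := gl_one_apply_ne_zero φ.1
  have h2 := gl_one_apply_ne_zero φ.2
  simp only [invariants, smul_A₁_apply, smul_A₂_apply, smul_C_apply]
  split_ifs
  · congr 1
    · field_simp
    · congr 1
      field_simp
  · congr 1
    · field_simp
    · congr 1
      field_simp

theorem exists_smul_eq_ofInvariants [NeZero n] (h1 : x.P1) (he : x.e 0 ≠ 0) {i : Fin 2}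
    (hi : pivot i x ≠ 0) : ∃ φ : GL (Fin 1) ℂ × GL (Fin 1) ℂ,
      φ • x = ofInvariants n i (invariants i x) := by
  -- As `e` is divided by φ₁ and each `A_i` is multiplied by φ₂/φ₁, the choice φ₁ = ε, φ₂ = ε/pivot
  -- turns `e` and the pivot into 1.
  obtain ⟨g₁, hg₁⟩ := exists_gl_one_apply_eq he
  obtain ⟨g₂, hg₂⟩ := exists_gl_one_apply_eq (div_ne_zero he hi)
  refine ⟨(g₁, g₂), ext_apply ?_ ?_ (fun q => ?_) ?_⟩
  · rw [smul_A₁_apply, hg₁, hg₂]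
    fin_cases i <;> simp [pivot, ofInvariants, invariants, ofScalars] at hi ⊢ <;> field_simp
  · rw [smul_A₂_apply, hg₁, hg₂]
    fin_cases i <;> simp [pivot, ofInvariants, invariants, ofScalars] at hi ⊢ <;> field_simp
  · rw [smul_C_apply, hg₁, hg₂]
    obtain ⟨q, hq⟩ := q
    fin_cases i
    · have h := h1.pow_mul_apply q (n - 1 - q) (by omega)
      have hqn : (⟨q + (n - 1 - q), by omega⟩ : Fin n) =
        ⟨n - 1, Nat.sub_one_lt (NeZero.ne n)⟩ := Fin.ext (by simp; omega)
      rw [hqn] at h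
      simp [pivot, ofInvariants, invariants, ofScalars] at hi ⊢
      rw [div_pow]
      field_simp
      linear_combination h
    · have h := h1.pow_mul_apply 0 q (by omega)
      simp only [zero_add] at h
      change _ * x.C 0 0 0 = _ at h
      simp [pivot, ofInvariants, invariants, ofScalars] at hi ⊢
      rw [div_pow]
      field_simp
      linear_combination -h
  · rw [smul_e_apply, hg₁]
    fin_cases i <;> simp [ofInvariants, ofScalars, he]

/-- The point of the total space of `O(-n)` that is given by the invariants of a datum. -/
noncomputable def toTotO [NeZero n] (x : ADHMData n 1) : TotO n :=
  if pivot 0 x ≠ 0 then TotO.chart n 0 (invariants 0 x) else TotO.chart n 1 (invariants 1 x)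

/-- The choice of chart in `toTotO` is immaterial. On the overlap, (P1) supplies n-1 factors a₂/a₁
between γₙ and γ₁, and replacing a₁ by a₂ supplies the n-th. -/
theorem toTotO_eq_chart [NeZero n] (h1 : x.P1) {i : Fin 2} (hi : pivot i x ≠ 0) :
    toTotO x = TotO.chart n i (invariants i x) := by
  unfold toTotO
  split_ifs with h0
  · fin_cases i
    · rfl
    · have h := h1.pow_mul_apply 0 (n - 1) (by have := NeZero.pos n; omega)
      simp only [zero_add] at h
      change _ * x.C 0 0 0 = _ at h
      simp only [pivot, invariants, Fin.mk_one, if_true, one_ne_zero, if_false] at *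
      obtain ⟨m, rfl⟩ : ∃ m, n = m + 1 := ⟨n - 1, by have := NeZero.pos n; omega⟩
      simp only [Nat.add_sub_cancel] at h ⊢
      have hs : x.C ⟨m, by omega⟩ 0 0 * x.A₁ 0 0 * (x.A₂ 0 0 / x.A₁ 0 0) ^ (m + 1) =
          x.C 0 0 0 * x.A₂ 0 0 := by
        rw [div_pow]
        field_simp
        linear_combination (-x.A₁ 0 0 * x.A₂ 0 0) * h
      rw [TotO.chart_zero_eq_chart_one (div_ne_zero hi h0), inv_div, hs]
  · fin_cases i
    · exact absurd hi h0
    · rfl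

theorem toTotO_smul [NeZero n] (φ : GL (Fin 1) ℂ × GL (Fin 1) ℂ) : toTotO (φ • x) = toTotO x := by
  simp only [toTotO, pivot_smul_ne_zero, invariants_smul]

theorem toTotO_ofInvariants [NeZero n] (i : Fin 2) (z : Fin 2 → ℂ) :
    toTotO (ofInvariants n i z) = TotO.chart n i z := by
  rw [toTotO_eq_chart (ofInvariants_mem i z).1 (i := i) (by simp [pivot_ofInvariants]),
    invariants_ofInvariants]

theorem exists_pivot_ne_zero (h : x.P2) : ∃ i, pivot i x ≠ 0 :=
  h.apply_ne_zero.elim (fun h => ⟨0, h⟩) fun h => ⟨1, h⟩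

/-- Hence the base point of `toTotO x` is [a₁ : a₂], so it detects which pivots vanish. -/
theorem pivot_mul_frame [NeZero n] {j : Fin 2} (hj : pivot j x ≠ 0) (i : Fin 2) :
    pivot j x * TotO.frame j (invariants j x 0) i = pivot i x := by
  fin_cases j <;> fin_cases i <;>
    simp [pivot, invariants, TotO.frame] at hj ⊢ <;> field_simp

theorem pivot_ne_zero_of_toTotO_eq [NeZero n] {y : ADHMData n 1} (hx : x.P1) (hy : y.P1)
    (hy' : y.P2) (h : toTotO x = toTotO y) {i : Fin 2} (hi : pivot i x ≠ 0) : pivot i y ≠ 0 := by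
  obtain ⟨j, hj⟩ := exists_pivot_ne_zero hy'
  rw [toTotO_eq_chart hx hi, toTotO_eq_chart hy hj] at h
  obtain ⟨a, ha⟩ := (Projectivization.mk_eq_mk_iff' _ _ _ _ _).1 (congrArg TotO.base h)
  intro h0
  rw [← pivot_mul_frame hj i] at h0
  have ha' := congrFun ha i
  rw [Pi.smul_apply, (mul_eq_zero.1 h0).resolve_left hj, smul_zero] at ha'
  exact hi (by rw [← pivot_mul_frame hi i, ← ha', mul_zero])

end ADHMData

/-! ### Regularity and bijectivity of the orbit map -/

namespace ADHMSpace

open ADHMData SpaceWithFunctions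

variable {n : ℕ} [NeZero n]

theorem isMorphismOn_invariants (i : Fin 2)
    (U : TopologicalSpace.Opens (ADHMSpace n 1).carrier) (hU : ∀ x ∈ U, pivot i x.val ≠ 0) :
    IsMorphismOn (ADHMSpace n 1) (affineSpace ℂ (Fin 2)) U fun x => invariants i x.val := by
  have hA₁ : (ADHMSpace n 1).RegularOn U fun x => x.val.A₁ 0 0 :=
    regularOn_coord _ U (Sum.inl (0, 0))
  have hA₂ : (ADHMSpace n 1).RegularOn U fun x => x.val.A₂ 0 0 :=
    regularOn_coord _ U (Sum.inr (Sum.inl (0, 0)))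
  have hC (q : Fin n) : (ADHMSpace n 1).RegularOn U fun x => x.val.C q 0 0 :=
    regularOn_coord _ U (Sum.inr (Sum.inr (Sum.inl (q, 0, 0))))
  refine isMorphismOn_ofCoordinates fun j => ?_
  fin_cases i <;> fin_cases j
  · exact (ADHMSpace n 1).mul hA₂ ((ADHMSpace n 1).inv hA₁ hU)
  · exact (ADHMSpace n 1).mul (hC _) hA₁
  · exact (ADHMSpace n 1).mul hA₁ ((ADHMSpace n 1).inv hA₂ hU)
  · exact (ADHMSpace n 1).mul (hC _) hA₂

theorem isOpen_pivot_ne_zero (i : Fin 2) :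
    IsOpen {x : (ADHMSpace n 1).carrier | pivot i x.val ≠ 0} := by
  have h : (ADHMSpace n 1).RegularOn ⊤ fun x => pivot i x.val := by
    fin_cases i
    · exact regularOn_coord _ ⊤ (Sum.inl (0, 0))
    · exact regularOn_coord _ ⊤ (Sum.inr (Sum.inl (0, 0)))
  convert (ADHMSpace n 1).isOpen_ne_zero h using 1
  ext x
  exact ⟨fun hx => ⟨trivial, hx⟩, fun hx => hx.2⟩

theorem isMorphism_toTotO :
    IsMorphism (ADHMSpace n 1) (TotO.space n) fun x => toTotO x.val := by
  refine isMorphism_of_forall_exists_isMorphismOn fun x => ?_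
  obtain ⟨i, hi⟩ := exists_pivot_ne_zero x.2.2.1
  refine ⟨⟨_, isOpen_pivot_ne_zero i⟩, hi, ?_⟩
  have h := (isMorphism_final (fun _ : Fin 2 => affineSpace ℂ (Fin 2))
    (TotO.chart n) i).comp_isMorphismOn
      (isMorphismOn_invariants i ⟨_, isOpen_pivot_ne_zero (n := n) i⟩ fun y hy => hy)
  exact h.congr fun y hy => (toTotO_eq_chart y.2.1 hy).symm

/-- The section over the `i`-th chart. -/
def ofInvariants (n : ℕ) [NeZero n] (i : Fin 2) (z : Fin 2 → ℂ) : (ADHMSpace n 1).carrier :=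
  ⟨ADHMData.ofInvariants n i z, ofInvariants_mem i z⟩

theorem isMorphism_ofInvariants (i : Fin 2) :
    IsMorphism (affineSpace ℂ (Fin 2)) (ADHMSpace n 1) (ofInvariants n i) := by
  have key (p : MvPolynomial (Fin 2) ℂ) :
      (affineSpace ℂ (Fin 2)).RegularOn ⊤ fun z => MvPolynomial.eval z p :=
    regularOn_eval _ (regularOn_coord (fun z : Fin 2 → ℂ => z) ⊤) p
  have h1 : (affineSpace ℂ (Fin 2)).RegularOn ⊤ fun _ => 1 := (affineSpace ℂ (Fin 2)).const ⊤ 1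
  have h0 : (affineSpace ℂ (Fin 2)).RegularOn ⊤ fun z => z 0 :=
    regularOn_coord (fun z : Fin 2 → ℂ => z) ⊤ 0
  have hC (m : ℕ) : (affineSpace ℂ (Fin 2)).RegularOn ⊤ fun z => z 1 * z 0 ^ m :=
    (affineSpace ℂ (Fin 2)).congr (fun (z : Fin 2 → ℂ) _ => by simp) (key (.X 1 * .X 0 ^ m))
  refine isMorphism_ofCoordinates fun j => ?_
  fin_cases i
  · rcases j with j | j | j | j
    exacts [h1, h0, hC _, h1]
  · rcases j with j | j | j | j
    exacts [h0, h1, hC _, h1]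

/-- The map on orbits that is induced by `ADHMData.toTotO`. -/
noncomputable def quotientToTotO :
    MulAction.orbitRel.Quotient (GL (Fin 1) ℂ × GL (Fin 1) ℂ) (ADHMSpace n 1).carrier → TotO n :=
  Quotient.lift (fun x => toTotO x.val) (by
    rintro _ y ⟨φ, rfl⟩
    exact toTotO_smul φ)

theorem mk_eq_mk_ofInvariants (x : (ADHMSpace n 1).carrier) {i : Fin 2}
    (hi : pivot i x.val ≠ 0) :
    (Quotient.mk _ x : MulAction.orbitRel.Quotient (GL (Fin 1) ℂ × GL (Fin 1) ℂ) _) =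
      Quotient.mk _ (ofInvariants n i (invariants i x.val)) := by
  obtain ⟨φ, hφ⟩ := exists_smul_eq_ofInvariants x.2.1 (e_ne_zero x.2.1 x.2.2.1 x.2.2.2) hi
  have h : φ • x = ofInvariants n i (invariants i x.val) := Subtype.ext hφ
  rw [← h]
  exact (MulAction.orbitRel.Quotient.quotient_smul_eq).symm

theorem quotientToTotO_mk_ofInvariants (i : Fin 2) (z : Fin 2 → ℂ) :
    quotientToTotO (Quotient.mk _ (ofInvariants n i z)) = TotO.chart n i z :=
  toTotO_ofInvariants i z

/-- Two orbits with the same image lie over a common chart, where equal invariants give the same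
normal form. Surjectivity holds because normal forms realise every chart point. -/
theorem quotientToTotO_bijective : Function.Bijective (quotientToTotO (n := n)) := by
  constructor
  · intro a b h
    induction a using Quotient.inductionOn with | _ x => ?_
    induction b using Quotient.inductionOn with | _ y => ?_
    obtain ⟨i, hi⟩ := exists_pivot_ne_zero x.2.2.1
    replace h : toTotO x.val = toTotO y.val := h
    have hi' := pivot_ne_zero_of_toTotO_eq x.2.1 y.2.1 y.2.2.1 h hi
    rw [mk_eq_mk_ofInvariants x hi, mk_eq_mk_ofInvariants y hi']
    rw [toTotO_eq_chart x.2.1 hi, toTotO_eq_chart y.2.1 hi'] at h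
    rw [TotO.chart_injective i h]
  · intro w
    obtain ⟨i, z, rfl⟩ := TotO.exists_chart_eq w
    exact ⟨_, quotientToTotO_mk_ofInvariants i z⟩

end ADHMSpace

theorem proposition2p2 (n : ℕ) [NeZero n] :
    Nonempty (SpaceWithFunctions.Iso
      ((ADHMSpace n 1).quotient (GL (Fin 1) ℂ × GL (Fin 1) ℂ)) (TotO.space n)) := by
  let E := Equiv.ofBijective _ (ADHMSpace.quotientToTotO_bijective (n := n))
  refine ⟨⟨E, ?_, ?_⟩⟩
  · exact SpaceWithFunctions.isMorphism_of_comp_final fun _ => ADHMSpace.isMorphism_toTotO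
  · refine SpaceWithFunctions.isMorphism_of_comp_final fun i => ?_
    -- On each chart the inverse lifts to the polynomial section, so it is a composite of morphisms.
    have h : E.symm ∘ TotO.chart n i = Quotient.mk _ ∘ ADHMSpace.ofInvariants n i := by
      ext z
      exact E.symm_apply_eq.2 (ADHMSpace.quotientToTotO_mk_ofInvariants i z).symm
    have h' := (SpaceWithFunctions.isMorphism_final (fun _ : Unit => ADHMSpace n 1)
      (fun _ x => (Quotient.mk _ x : MulAction.orbitRel.Quotient
        (GL (Fin 1) ℂ × GL (Fin 1) ℂ) _)) ()).comp (ADHMSpace.isMorphism_ofInvariants i)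
    exact h ▸ h'
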